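/- Let $d\ge 0$ be an integer, let $[d+1]=\{1,\dots,d+1\}$, and let $S^d\subseteq\mathbb{R}^{d+1}$ be the Euclidean unit sphere. For a set $A\subseteq\mathbb{R}^{d+1}$ and $s\in\{-1,+1\}$ write $sA=\{sx : x\in A\}$ and $-A=(-1)A$. For each $j\in[d+1]$ let $A_1^{(j)},\dots,A_{d+1}^{(j)}\subseteq S^d$ be closed sets such that $$S^d=\bigcup_{i=1}^{d+1}A_i^{(j)}\cup\bigcup_{i=1}^{d+1}\bigl(-A_i^{(j)}\bigr).$$ Suppose that $A_i^{(j)}\cap\bigl(-A_i^{(\ell)}\bigr)=\emptyset$ for all $i\in[d+1]$ and all $j,\ell\in[d+1]$ with $j\ne\ell$. Then for every choice of signs $s_1,\dots,s_{d+1}\in\{-1,+1\}$ there is a permutation $\pi$ of $[d+1]$ such that $$\bigcap_{i=1}^{d+1}s_iA_i^{(\pi(i))}\neq\emptyset.$$ -/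

import Mathlib

open scoped Pointwise

/-!
The proof applies Ky Fan's combinatorial lemma to a triangulation whose vertices are coloured by
dimension.

Pull the sets back radially from the round sphere to the boundary of the cross-polytope and
triangulate the latter finely, by iterated barycentric subdivision. A vertex is the barycentre of a
simplex of the previous subdivision; its colour is the dimension of that simplex, so that the
vertices of one simplex have distinct colours. Label a vertex `x` of colour `j` by a pair `(i, ±)`
with `x` in `± A j i`, antipodally. Two opposite labels `(i, +)` and `(i, -)` on a simplex would
belong to vertices of different colours, hence to a pair of nearby points of `A j i` and `-A l i`
with `j ≠ l`. As these sets are disjoint and compact, this is impossible for a fine triangulation.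
Ky Fan's lemma (`exists_alternating`) now provides a `d`-simplex whose labels, sorted by index,
alternate in sign; with only `d + 1` indices, each index appears exactly once. After twisting the
signs in the labels, the alternating pattern becomes the prescribed pattern `s`. The colours on that
simplex give the permutation (`exists_perm_close`), and a Lebesgue number argument
(`exists_pos_forall_not_close`), applied to the finitely many permutations, turns nearby points of
closed sets into a common point.

Ky Fan's lemma is proved with mod-2 chains. All that is needed of the triangulation is a sequence
of chains `h k` such that the boundary of `h (k + 1)` is `h k` plus its antipode and `h 0` is one
vertex (`IsHemisphereTower`). In the cross-polytope such hemispheres arise as iterated cones, and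
subdivision, being an antipodally symmetric chain map, preserves the property. The cochain that
detects simplices with alternating labels starting with `+` has as coboundary the sum of itself and
of its antipodal image (`coboundary_alternating`). Evaluating on the hemispheres shows that the
number of such simplices in the `k`-sphere has a parity independent of `k`, which is odd for `k = 0`.
-/

namespace ColorfulFan

/-! ### Mod-2 chains of ordered simplices -/

variable {V W : Type*}

/-- The faces of an ordered simplex, obtained by deleting one vertex. Chains with coefficients in
`ZMod 2` are encoded as lists of ordered simplices, an ordered simplex being the list of its
vertices; the empty simplex is allowed, so the chain complex is augmented. -/
def faces : List V → List (List V)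
  | [] => []
  | x :: l => l :: (faces l).map (x :: ·)

/-- The value of the mod-2 cochain `f` on the chain `c`. Two lists of simplices represent the same
chain exactly when all cochains agree on them, and this is how identities of chains are stated. -/
def eval (f : List V → ZMod 2) (c : List (List V)) : ZMod 2 := (c.map f).sum

/-- The coboundary of a mod-2 cochain. -/
def coboundary (f : List V → ZMod 2) (l : List V) : ZMod 2 := eval f (faces l)

@[simp] lemma eval_nil (f : List V → ZMod 2) : eval f [] = 0 := rfl

@[simp] lemma eval_cons (f : List V → ZMod 2) (l : List V) (c : List (List V)) :
    eval f (l :: c) = f l + eval f c := by simp [eval]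

@[simp] lemma eval_append (f : List V → ZMod 2) (c c' : List (List V)) :
    eval f (c ++ c') = eval f c + eval f c' := by simp [eval]

lemma eval_map (f : List W → ZMod 2) (g : List V → List W) (c : List (List V)) :
    eval f (c.map g) = eval (fun l => f (g l)) c := by
  simp [eval, Function.comp_def]

lemma eval_flatMap (f : List W → ZMod 2) (g : List V → List (List W)) (c : List (List V)) :
    eval f (c.flatMap g) = eval (fun l => eval f (g l)) c := by
  induction c with
  | nil => rfl
  | cons l c ih => simp [ih]

lemma eval_add (f g : List V → ZMod 2) (c : List (List V)) :
    eval (fun l => f l + g l) c = eval f c + eval g c := by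
  simp [eval, List.sum_map_add]

lemma eval_congr {f g : List V → ZMod 2} {c : List (List V)} (h : ∀ l ∈ c, f l = g l) :
    eval f c = eval g c := by
  rw [eval, eval, List.map_congr_left h]

lemma exists_ne_zero_of_eval_ne_zero {f : List V → ZMod 2} {c : List (List V)}
    (h : eval f c ≠ 0) : ∃ l ∈ c, f l ≠ 0 := by
  by_contra! H
  apply h
  rw [eval_congr (g := fun _ => 0) H]
  simp [eval]

@[simp] lemma coboundary_nil (f : List V → ZMod 2) : coboundary f [] = 0 := rfl

lemma coboundary_cons (f : List V → ZMod 2) (x : V) (l : List V) :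
    coboundary f (x :: l) = f l + coboundary (fun t => f (x :: t)) l := by
  simp [coboundary, faces, eval_map]

/-- The boundary of a boundary vanishes. -/
lemma coboundary_coboundary (f : List V → ZMod 2) (l : List V) :
    coboundary (coboundary f) l = 0 := by
  induction l generalizing f with
  | nil => rfl
  | cons x l ih =>
    rw [coboundary_cons]
    have : coboundary (fun t => coboundary f (x :: t)) l
        = coboundary f l + coboundary (coboundary fun t => f (x :: t)) l := by
      simp only [coboundary_cons f]
      exact eval_add _ _ _
    rw [this, ih, add_zero, CharTwo.add_self_eq_zero]

lemma faces_map (g : V → W) (l : List V) :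
    faces (l.map g) = (faces l).map (List.map g) := by
  induction l with
  | nil => rfl
  | cons x l ih => simp [faces, ih, Function.comp_def]

lemma coboundary_map (f : List W → ZMod 2) (g : V → W) (l : List V) :
    coboundary f (l.map g) = coboundary (fun t => f (t.map g)) l := by
  simp [coboundary, faces_map, eval_map]

lemma length_of_mem_faces {l t : List V} (h : t ∈ faces l) : t.length + 1 = l.length := by
  induction l generalizing t with
  | nil => simp [faces] at h
  | cons x l ih =>
    simp only [faces, List.mem_cons, List.mem_map] at h
    rcases h with rfl | ⟨u, hu, rfl⟩
    · simp
    · simp [ih hu]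

lemma sublist_of_mem_faces {l t : List V} (h : t ∈ faces l) : t.Sublist l := by
  induction l generalizing t with
  | nil => simp [faces] at h
  | cons x l ih =>
    simp only [faces, List.mem_cons, List.mem_map] at h
    rcases h with rfl | ⟨u, hu, rfl⟩
    · simp
    · exact (ih hu).cons_cons x

/-- The coboundary of a cochain that does not depend on the order of the vertices does not depend
on it either. -/
lemma coboundary_perm {f : List V → ZMod 2} (hf : ∀ l l' : List V, l.Perm l' → f l = f l')
    {l l' : List V} (h : l.Perm l') : coboundary f l = coboundary f l' := by
  induction h generalizing f with
  | nil => rfl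
  | cons x h ih =>
    rw [coboundary_cons, coboundary_cons, hf _ _ h, ih fun _ _ ht => hf _ _ (ht.cons x)]
  | swap x y l =>
    simp only [coboundary_cons]
    have : (fun t => f (x :: y :: t)) = fun t => f (y :: x :: t) :=
      funext fun t => hf _ _ (List.Perm.swap y x t)
    rw [this]
    ring
  | trans _ _ ih₁ ih₂ => exact (ih₁ hf).trans (ih₂ hf)

/-! ### Towers of hemispheres -/

/-- Chains behaving like the hemispheres of an antipodally symmetric triangulation of a sphere,
with antipodal map `a`: `h 0` is a vertex, and the boundary of the `(k+1)`-dimensional hemisphere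
`h (k + 1)` is the `k`-sphere made of `h k` and its antipode. -/
structure IsHemisphereTower (a : V → V) (h : ℕ → List (List V)) : Prop where
  length_eq : ∀ k, ∀ l ∈ h k, l.length = k + 1
  eval_zero : ∀ f, eval (coboundary f) (h 0) = f []
  eval_succ : ∀ k f, eval (coboundary f) (h (k + 1)) = eval f (h k ++ (h k).map (List.map a))

/-- The hemispheres of the boundary of the cross-polytope with vertices `e k` and `a (e k)`. -/
def crossHemisphere (a : V → V) (e : ℕ → V) : ℕ → List (List V)
  | 0 => [[e 0]]
  | k + 1 => (crossHemisphere a e k ++ (crossHemisphere a e k).map (List.map a)).map (e (k + 1) :: ·)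

lemma isHemisphereTower_crossHemisphere {a : V → V} (ha : Function.Involutive a) (e : ℕ → V) :
    IsHemisphereTower a (crossHemisphere a e) := by
  -- The boundary of a cone is its base plus the cone over the boundary of the base; the latter
  -- vanishes, since the sphere that forms the base is a cycle.
  have hzero (f : List V → ZMod 2) :
      eval (coboundary f) (crossHemisphere a e 0) = f [] := by
    simp [crossHemisphere, coboundary_cons]
  have hcone (k : ℕ) (f : List V → ZMod 2) :
      eval (coboundary f) (crossHemisphere a e (k + 1)) =
        eval f (crossHemisphere a e k ++ (crossHemisphere a e k).map (List.map a)) +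
        eval (coboundary fun t => f (e (k + 1) :: t))
          (crossHemisphere a e k ++ (crossHemisphere a e k).map (List.map a)) := by
    rw [crossHemisphere, eval_map]
    simp only [coboundary_cons]
    rw [eval_add]
  have hcycle (k : ℕ) : ∀ f : List V → ZMod 2, eval (coboundary f)
      (crossHemisphere a e k ++ (crossHemisphere a e k).map (List.map a)) = 0 := by
    induction k with
    | zero =>
      intro f
      simp [crossHemisphere, coboundary_cons, CharTwo.add_self_eq_zero]
    | succ k ih =>
      intro f
      rw [eval_append, eval_map]
      simp only [coboundary_map]
      rw [hcone, hcone, ih, ih]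
      simp only [eval_append, eval_map, List.map_map, ha.comp_self, List.map_id, add_zero]
      rw [add_comm (eval (fun l => f (l.map a)) _), CharTwo.add_self_eq_zero]
  refine ⟨fun k => ?_, hzero, fun k f => by rw [hcone, hcycle, add_zero]⟩
  induction k with
  | zero => simp [crossHemisphere]
  | succ k ih =>
    intro l hl
    simp only [crossHemisphere, List.mem_map, List.mem_append] at hl
    obtain ⟨t, ht | ⟨u, hu, rfl⟩, rfl⟩ := hl
    · simp [ih t ht]
    · simp [ih u hu]

/-! ### Subdivision -/

/-- The subdivision of a simplex with `n` vertices: the cone, with apex `b l` for the simplex `l`,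
over the subdivision of its boundary. -/
def subdiv (b : List V → W) : ℕ → List V → List (List W)
  | 0, _ => [[]]
  | n + 1, l => ((faces l).flatMap (subdiv b n)).map (b l :: ·)

/-- Subdivision commutes with the boundary. -/
lemma eval_coboundary_subdiv (b : List V → W) (n : ℕ) (f : List W → ZMod 2) (l : List V) :
    eval (coboundary f) (subdiv b (n + 1) l) = coboundary (fun t => eval f (subdiv b n t)) l := by
  have hcone (n : ℕ) (f : List W → ZMod 2) (l : List V) :
      eval (coboundary f) (subdiv b (n + 1) l) = coboundary (fun t => eval f (subdiv b n t)) l +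
        coboundary (fun t => eval (coboundary fun u => f (b l :: u)) (subdiv b n t)) l := by
    rw [subdiv, eval_map]
    simp only [coboundary_cons]
    rw [eval_add, eval_flatMap, eval_flatMap]
    rfl
  induction n generalizing f l with
  | zero =>
    rw [hcone]
    simp [subdiv, coboundary, eval, faces]
  | succ n ih =>
    rw [hcone]
    simp only [ih]
    rw [add_eq_left]
    exact coboundary_coboundary _ _

lemma length_of_mem_subdiv {b : List V → W} {n : ℕ} {l : List V} {t : List W}
    (h : t ∈ subdiv b n l) : t.length = n := by
  induction n generalizing l t with
  | zero => simp_all [subdiv]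
  | succ n ih =>
    simp only [subdiv, List.mem_map, List.mem_flatMap] at h
    obtain ⟨u, ⟨v, -, hu⟩, rfl⟩ := h
    simp [ih hu]

lemma subdiv_map {a : V → V} {b : List V → V} (hb : ∀ l : List V, b (l.map a) = a (b l))
    (n : ℕ) (l : List V) : subdiv b n (l.map a) = (subdiv b n l).map (List.map a) := by
  induction n generalizing l with
  | zero => rfl
  | succ n ih =>
    simp only [subdiv, faces_map, hb, List.flatMap_map, ih, List.map_flatMap, List.map_map]
    rfl

/-- An antipodally symmetric subdivision of a tower of hemispheres is a tower of hemispheres. -/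
lemma IsHemisphereTower.subdiv {a : V → V} {h : ℕ → List (List V)} (H : IsHemisphereTower a h)
    {b : List V → V} (hb : ∀ l : List V, b (l.map a) = a (b l)) :
    IsHemisphereTower a fun k => (h k).flatMap (subdiv b (k + 1)) := by
  refine ⟨fun k l hl => ?_, fun f => ?_, fun k f => ?_⟩
  · obtain ⟨t, -, ht⟩ := List.mem_flatMap.1 hl
    exact length_of_mem_subdiv ht
  · simp only [eval_flatMap, eval_coboundary_subdiv]
    exact (H.eval_zero _).trans (by simp [ColorfulFan.subdiv])
  · simp only [eval_flatMap, eval_coboundary_subdiv]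
    refine (H.eval_succ _ _).trans ?_
    simp only [eval_append, eval_map, eval_flatMap, subdiv_map hb]

/-! ### Ky Fan's lemma -/

section Fan

variable {ι : Type*}

/-- The label with the same index and the opposite sign. A label is an index together with a sign;
labels are ordered by their index first. -/
def opp (x : ι ×ₗ Bool) : ι ×ₗ Bool := toLex ((ofLex x).1, !(ofLex x).2)

/-- The cochain which is `1` on the lists of labels whose signs alternate, the first one being
`b`. -/
def alternating : Bool → List (ι ×ₗ Bool) → ZMod 2
  | _, [] => 1
  | b, x :: l => if (ofLex x).2 = b then alternating (!b) l else 0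

/-- A face of a list with non-alternating signs that has alternating signs comes with exactly one
other such face, deletion of either of two equal neighbouring signs having the same effect. -/
lemma coboundary_alternating (b : Bool) (l : List (ι ×ₗ Bool)) :
    coboundary (alternating b) l = alternating b l + alternating (!b) l := by
  induction l generalizing b with
  | nil => simp [alternating, CharTwo.add_self_eq_zero]
  | cons x l ih =>
    rw [coboundary_cons]
    by_cases hx : (ofLex x).2 = b
    · simp only [alternating, hx, if_true, Bool.eq_not_self, if_false, add_zero]
      rw [show (fun t : List (ι ×ₗ Bool) => alternating (!b) t) = alternating (!b) from rfl, ih,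
        Bool.not_not, add_left_comm, CharTwo.add_self_eq_zero, add_zero]
    · have hx' : (ofLex x).2 = !b := by simpa [Bool.eq_not] using hx
      simp [alternating, hx', coboundary, eval]

lemma alternating_map_opp (b : Bool) (l : List (ι ×ₗ Bool)) :
    alternating b (l.map opp) = alternating (!b) l := by
  induction l generalizing b with
  | nil => rfl
  | cons x l ih => cases b <;> cases hx : (ofLex x).2 <;> simp [alternating, opp, hx, ih]

lemma sign_of_alternating {b : Bool} {l : List (ι ×ₗ Bool)} (h : alternating b l ≠ 0)
    (i : ℕ) (hi : i < l.length) : (ofLex l[i]).2 = (b == decide (Even i)) := by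
  induction l generalizing b i with
  | nil => simp at hi
  | cons x l ih =>
    have hx : (ofLex x).2 = b := by
      by_contra hx
      simp [alternating, hx] at h
    cases i with
    | zero => simp [hx]
    | succ i =>
      have := ih (b := !b) (by simpa [alternating, hx] using h) i (by simpa using hi)
      rw [List.getElem_cons_succ, this]
      cases b <;> by_cases hev : Even i <;> simp [Nat.even_add_one, hev]

variable [LinearOrder ι]

/-- The list of the labels of a simplex, sorted. -/
def sortedLabels (lab : V → ι ×ₗ Bool) (l : List V) : List (ι ×ₗ Bool) :=
  (l.map lab).insertionSort (· ≤ ·)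

/-- No two vertices of the simplex `l` have opposite labels. -/
def ComplementFree (lab : V → ι ×ₗ Bool) (l : List V) : Prop :=
  ∀ v ∈ l, ∀ w ∈ l, lab w ≠ opp (lab v)

lemma mem_sortedLabels {lab : V → ι ×ₗ Bool} {l : List V} {x : ι ×ₗ Bool} :
    x ∈ sortedLabels lab l ↔ ∃ v ∈ l, lab v = x := by
  rw [sortedLabels, (List.perm_insertionSort _ _).mem_iff, List.mem_map]

lemma pairwise_sortedLabels (lab : V → ι ×ₗ Bool) (l : List V) :
    (sortedLabels lab l).Pairwise (· ≤ ·) := List.pairwise_insertionSort _ _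

lemma coboundary_alternating_sortedLabels (lab : V → ι ×ₗ Bool) (b : Bool) (l : List V) :
    coboundary (fun t => alternating b (sortedLabels lab t)) l =
      alternating b (sortedLabels lab l) + alternating (!b) (sortedLabels lab l) := by
  have h1 := coboundary_map
    (fun t : List (ι ×ₗ Bool) => alternating b (t.insertionSort (· ≤ ·))) lab l
  refine h1.symm.trans ?_
  rw [coboundary_perm (l' := sortedLabels lab l) ?_ (List.perm_insertionSort _ _).symm,
    ← coboundary_alternating]
  · refine eval_congr fun t ht => ?_
    rw [List.Pairwise.insertionSort_eq
      ((pairwise_sortedLabels lab l).sublist (sublist_of_mem_faces ht))]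
  · intro t t' ht
    congr 1
    exact List.Perm.eq_of_pairwise' (List.pairwise_insertionSort _ _)
      (List.pairwise_insertionSort _ _) ((List.perm_insertionSort _ _).trans
        (ht.trans (List.perm_insertionSort _ _).symm))

lemma opp_le_opp {x y : ι ×ₗ Bool} (h : x ≤ y) (hne : y ≠ opp x) : opp x ≤ opp y := by
  rw [Prod.Lex.le_iff] at h ⊢
  rcases h with h | ⟨h, h'⟩
  · exact Or.inl h
  · right
    refine ⟨h, ?_⟩
    have : (ofLex x).2 = (ofLex y).2 := by
      by_contra hxy
      apply hne
      apply ofLex.injective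
      refine Prod.ext h.symm ?_
      simpa [opp, Bool.eq_not] using fun e => hxy e.symm
    simp [opp, this]

lemma sortedLabels_map {a : V → V} {lab : V → ι ×ₗ Bool} {l : List V}
    (hlab : ∀ v ∈ l, lab (a v) = opp (lab v)) (hl : ComplementFree lab l) :
    sortedLabels lab (l.map a) = (sortedLabels lab l).map opp := by
  refine List.Perm.eq_of_pairwise' (pairwise_sortedLabels _ _) ?_ ?_
  · rw [List.pairwise_map]
    refine (pairwise_sortedLabels lab l).imp_of_mem fun {x y} hx hy hxy => ?_
    obtain ⟨v, hv, rfl⟩ := mem_sortedLabels.1 hx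
    obtain ⟨w, hw, rfl⟩ := mem_sortedLabels.1 hy
    exact opp_le_opp hxy (hl v hv w hw)
  · refine (List.perm_insertionSort _ _).trans ?_
    rw [List.map_map, show l.map (lab ∘ a) = l.map (opp ∘ lab) from List.map_congr_left hlab, ← List.map_map]
    exact (List.perm_insertionSort _ _).symm.map _

/-- **Ky Fan's lemma** for towers of hemispheres: if the labelling is antipodal and no simplex has
opposite labels, then some simplex of the `k`-sphere has labels with alternating signs. The number
of such simplices is odd in every dimension: the coboundary of the alternating cochain sends
`h (k + 1)` to their number in the `k`-sphere, and also to their number in the `(k + 1)`-sphere. -/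
theorem exists_alternating {a : V → V} {h : ℕ → List (List V)} (H : IsHemisphereTower a h)
    (lab : V → ι ×ₗ Bool) (k : ℕ)
    (hlab : ∀ j ≤ k, ∀ l ∈ h j, ∀ v ∈ l, lab (a v) = opp (lab v))
    (hcf : ∀ j ≤ k, ∀ l ∈ h j, ComplementFree lab l) :
    ∃ l ∈ h k ++ (h k).map (List.map a), alternating true (sortedLabels lab l) ≠ 0 := by
  have key (j : ℕ) (hj : j ≤ k) :
      eval (coboundary fun l => alternating true (sortedLabels lab l)) (h j) =
      eval (fun l => alternating true (sortedLabels lab l)) (h j ++ (h j).map (List.map a)) := by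
    rw [eval_append, eval_map, ← eval_add]
    refine eval_congr fun l hl => ?_
    rw [coboundary_alternating_sortedLabels, sortedLabels_map (hlab j hj l hl) (hcf j hj l hl),
      alternating_map_opp]
  have odd (j : ℕ) (hj : j ≤ k) :
      eval (fun l => alternating true (sortedLabels lab l)) (h j ++ (h j).map (List.map a))
        = 1 := by
    induction j with
    | zero =>
      rw [← key 0 hj, H.eval_zero]
      rfl
    | succ j ih => rw [← key _ hj, H.eval_succ, ih (by omega)]
  exact exists_ne_zero_of_eval_ne_zero (by rw [odd k le_rfl]; exact one_ne_zero)

end Fan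

/-- With `n` indices, a simplex with `n` vertices, no opposite labels and alternating signs carries
every index exactly once, with sign given by the parity of the index. -/
lemma exists_label_of_alternating {n : ℕ} {lab : V → Fin n ×ₗ Bool} {l : List V}
    (hlen : l.length = n) (hcf : ComplementFree lab l)
    (h : alternating true (sortedLabels lab l) ≠ 0) (i : Fin n) :
    ∃ v ∈ l, lab v = toLex (i, decide (Even (i : ℕ))) := by
  have hs : (sortedLabels lab l).length = n := by simp [sortedLabels, hlen]
  have hmono : StrictMono fun j : Fin n => (ofLex ((sortedLabels lab l)[j])).1 := by
    cases n with
    | zero => exact fun x => x.elim0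
    | succ n =>
      rw [Fin.strictMono_iff_lt_succ]
      intro j
      have hle := List.pairwise_iff_getElem.1 (pairwise_sortedLabels lab l) j (j + 1)
        (by omega) (by omega) (by omega)
      rcases Prod.Lex.le_iff.1 hle with hlt | ⟨heq, -⟩
      · exact hlt
      · exfalso
        obtain ⟨v, hv, hv'⟩ := mem_sortedLabels.1
          (List.getElem_mem (l := sortedLabels lab l) (n := j) (by omega))
        obtain ⟨w, hw, hw'⟩ := mem_sortedLabels.1
          (List.getElem_mem (l := sortedLabels lab l) (n := j + 1) (by omega))
        refine hcf v hv w hw ?_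
        rw [hv', hw']
        apply ofLex.injective
        refine Prod.ext heq.symm ?_
        rw [sign_of_alternating h]
        simp only [opp, ofLex_toLex]
        rw [sign_of_alternating h]
        by_cases hev : Even (j : ℕ) <;> simp [Nat.even_add_one, hev]
  have hid : (ofLex ((sortedLabels lab l)[i])).1 = i := hmono.apply_eq
  obtain ⟨v, hv, hv'⟩ := mem_sortedLabels.1
    (List.getElem_mem (l := sortedLabels lab l) (n := i) (by omega))
  refine ⟨v, hv, ?_⟩
  rw [hv']
  apply ofLex.injective
  refine Prod.ext hid ?_
  rw [sign_of_alternating h]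
  simp

/-! ### Barycentric subdivision -/

section Barycentric

variable {E : Type*} [NormedAddCommGroup E]

/-- The antipode of a coloured point. A vertex is a point together with a colour, which after
subdivision is the dimension of the simplex whose barycentre the vertex is. -/
def antipode (v : ℕ × E) : ℕ × E := (v.1, -v.2)

lemma antipode_involutive : Function.Involutive (antipode : ℕ × E → ℕ × E) :=
  fun v => by simp [antipode]

variable [NormedSpace ℝ E]

/-- The barycentre of a simplex, coloured by the dimension of the simplex. -/
noncomputable def barycenter (l : List (ℕ × E)) : ℕ × E :=
  (l.length - 1, (l.length : ℝ)⁻¹ • (l.map Prod.snd).sum)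

lemma barycenter_map_antipode (l : List (ℕ × E)) :
    barycenter (l.map antipode) = antipode (barycenter l) := by
  have : ((l.map antipode).map Prod.snd).sum = -(l.map Prod.snd).sum := by
    induction l with
    | nil => simp
    | cons x l ih =>
      simp only [List.map_cons, List.sum_cons, ih, neg_add_rev]
      simp [antipode, add_comm]
  rw [barycenter, this]
  simp [barycenter, antipode]

lemma norm_sum_sub_le {x : E} {D : ℝ} (l : List (ℕ × E)) (h : ∀ v ∈ l, dist v.2 x ≤ D) :
    ‖(l.map Prod.snd).sum - (l.length : ℝ) • x‖ ≤ l.length * D := by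
  induction l with
  | nil => simp
  | cons v l ih =>
    have h1 : ‖v.2 - x‖ ≤ D := by simpa [dist_eq_norm] using h v (by simp)
    have h2 := ih fun w hw => h w (by simp [hw])
    have : ((v :: l).map Prod.snd).sum - ((v :: l).length : ℝ) • x
        = (v.2 - x) + ((l.map Prod.snd).sum - (l.length : ℝ) • x) := by
      simp only [List.map_cons, List.sum_cons, List.length_cons]
      push_cast
      module
    rw [this, List.length_cons]
    push_cast
    linarith [norm_add_le (v.2 - x) ((l.map Prod.snd).sum - (l.length : ℝ) • x)]

lemma barycenter_snd_mem {C : Set E} (hC : Convex ℝ C) {l : List (ℕ × E)} (hl : l ≠ [])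
    (h : ∀ v ∈ l, v.2 ∈ C) : (barycenter l).2 ∈ C := by
  induction l with
  | nil => exact absurd rfl hl
  | cons v l ih =>
    rcases eq_or_ne l [] with rfl | hl'
    · simpa [barycenter] using h v (by simp)
    · have h0 : (0 : ℝ) < l.length := by exact_mod_cast List.length_pos_iff.2 hl'
      have := hC (h v (by simp)) (ih hl' fun w hw => h w (by simp [hw]))
        (a := ((l.length : ℝ) + 1)⁻¹) (b := l.length * ((l.length : ℝ) + 1)⁻¹)
        (by positivity) (by positivity) (by field_simp; ring)
      convert this using 1
      simp only [barycenter, List.map_cons, List.sum_cons, List.length_cons, smul_smul, smul_add]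
      push_cast
      congr 2
      field_simp

/-- The barycentre of a simplex with `n + 1` vertices and edges of length at most `D` is at
distance at most `n * D / (n + 1)` from each vertex. -/
lemma dist_barycenter_le {D : ℝ} {n : ℕ} {l : List (ℕ × E)} (hlen : l.length = n + 1)
    (h : ∀ v ∈ l, ∀ w ∈ l, dist v.2 w.2 ≤ D) {x : ℕ × E} (hx : x ∈ l) :
    dist x.2 (barycenter l).2 ≤ n / (n + 1) * D := by
  obtain ⟨t, ht⟩ : ∃ t, l.Perm (x :: t) := by
    classical exact ⟨_, List.perm_cons_erase hx⟩
  have htlen : t.length = n := by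
    have := ht.length_eq
    simp only [List.length_cons] at this
    omega
  have h1 := norm_sum_sub_le t (x := x.2) fun v hv =>
    h v (ht.mem_iff.2 (by simp [hv])) x hx
  have h2 : (l.map Prod.snd).sum = x.2 + (t.map Prod.snd).sum := by
    simpa using (ht.map Prod.snd).sum_eq
  have h3 : (barycenter l).2 - x.2
      = ((n : ℝ) + 1)⁻¹ • ((t.map Prod.snd).sum - (t.length : ℝ) • x.2) := by
    have hn : (n : ℝ) + 1 ≠ 0 := by positivity
    simp only [barycenter, h2, hlen, htlen]
    push_cast
    rw [← sub_eq_zero]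
    have : ((n : ℝ) + 1)⁻¹ • (x.2 + (t.map Prod.snd).sum) - x.2
        - ((n : ℝ) + 1)⁻¹ • ((t.map Prod.snd).sum - (n : ℝ) • x.2)
        = (((n : ℝ) + 1)⁻¹ * (n + 1) - 1) • x.2 := by module
    rw [this, inv_mul_cancel₀ hn, sub_self, zero_smul]
  rw [dist_comm, dist_eq_norm, h3, norm_smul, Real.norm_of_nonneg (by positivity), div_mul_eq_mul_div,
    div_eq_inv_mul]
  rw [htlen] at h1 ⊢
  gcongr

lemma snd_mem_of_mem_subdiv {C : Set E} (hC : Convex ℝ C) {n : ℕ} {l t : List (ℕ × E)}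
    (hlen : l.length = n) (h : ∀ v ∈ l, v.2 ∈ C) (ht : t ∈ subdiv barycenter n l) :
    ∀ v ∈ t, v.2 ∈ C := by
  induction n generalizing l t with
  | zero => simp_all [subdiv]
  | succ n ih =>
    simp only [subdiv, List.mem_map, List.mem_flatMap] at ht
    obtain ⟨u, ⟨s, hs, hu⟩, rfl⟩ := ht
    intro v hv
    rcases List.mem_cons.1 hv with rfl | hv
    · exact barycenter_snd_mem hC (by rintro rfl; simp at hlen) h
    · exact ih (by have := length_of_mem_faces hs; omega)
        (fun w hw => h w ((sublist_of_mem_faces hs).subset hw)) hu v hv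

/-- Barycentric subdivision shrinks the mesh by the factor `d / (d + 1)` in dimension `d`. -/
lemma dist_le_of_mem_subdiv {d : ℕ} {D : ℝ} (hD : 0 ≤ D) {n : ℕ} (hn : n ≤ d + 1)
    {l t : List (ℕ × E)} (hlen : l.length = n) (h : ∀ v ∈ l, ∀ w ∈ l, dist v.2 w.2 ≤ D)
    (ht : t ∈ subdiv barycenter n l) : ∀ v ∈ t, ∀ w ∈ t, dist v.2 w.2 ≤ d / (d + 1) * D := by
  induction n generalizing l t with
  | zero => simp_all [subdiv]
  | succ n ih =>
    simp only [subdiv, List.mem_map, List.mem_flatMap] at ht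
    obtain ⟨u, ⟨s, hs, hu⟩, rfl⟩ := ht
    have hslen : s.length = n := by have := length_of_mem_faces hs; omega
    have hsub := (sublist_of_mem_faces hs).subset
    have hfac : (n : ℝ) / (n + 1) ≤ d / (d + 1) := by
      rw [div_le_div_iff₀ (by positivity) (by positivity)]
      have : (n : ℝ) ≤ d := by exact_mod_cast Nat.le_of_succ_le_succ hn
      linarith
    have hcone : ∀ w ∈ u, dist w.2 (barycenter l).2 ≤ d / (d + 1) * D := fun w hw => by
      refine le_trans ?_ (mul_le_mul_of_nonneg_right hfac hD)
      exact snd_mem_of_mem_subdiv (convex_closedBall (barycenter l).2 _) hslen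
        (fun x hx => dist_barycenter_le hlen h (hsub hx)) hu w hw
    have hrest := ih (by omega) hslen (fun v hv w hw => h v (hsub hv) w (hsub hw)) hu
    intro v hv w hw
    rcases List.mem_cons.1 hv with rfl | hv' <;> rcases List.mem_cons.1 hw with rfl | hw'
    · rw [dist_self]
      positivity
    · rw [dist_comm]
      exact hcone w hw'
    · exact hcone v hv'
    · exact hrest v hv' w hw'

/-- The vertices of a simplex of the barycentric subdivision have distinct colours. -/
lemma fst_of_mem_subdiv {n : ℕ} {l t : List (ℕ × E)} (hlen : l.length = n)
    (ht : t ∈ subdiv barycenter n l) :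
    (∀ v ∈ t, v.1 < n) ∧ ∀ v ∈ t, ∀ w ∈ t, v.1 = w.1 → v = w := by
  induction n generalizing l t with
  | zero => simp_all [subdiv]
  | succ n ih =>
    simp only [subdiv, List.mem_map, List.mem_flatMap] at ht
    obtain ⟨u, ⟨s, hs, hu⟩, rfl⟩ := ht
    have hb : (barycenter l).1 = n := by simp [barycenter, hlen]
    obtain ⟨h1, h2⟩ := ih (by have := length_of_mem_faces hs; omega) hu
    constructor
    · intro v hv
      rcases List.mem_cons.1 hv with rfl | hv'
      · omega
      · exact (h1 v hv').trans n.lt_succ_self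
    · intro v hv w hw hvw
      rcases List.mem_cons.1 hv with rfl | hv' <;> rcases List.mem_cons.1 hw with rfl | hw'
      · rfl
      · have := h1 w hw'
        omega
      · have := h1 v hv'
        omega
      · exact h2 v hv' w hw' hvw

end Barycentric

/-! ### The boundary of the cross-polytope -/

/-- The boundary of the cross-polytope, that is, the unit sphere of the `ℓ¹` norm. -/
def crossBoundary (d : ℕ) : Set (EuclideanSpace ℝ (Fin (d + 1))) := {x | ∑ i, |x i| = 1}

lemma isCompact_crossBoundary (d : ℕ) : IsCompact (crossBoundary d) := by
  refine Metric.isCompact_of_isClosed_isBounded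
    (isClosed_eq (by fun_prop) continuous_const) ?_
  refine (Metric.isBounded_closedBall (x := 0) (r := Real.sqrt (d + 1))).subset fun x hx => ?_
  rw [mem_closedBall_zero_iff, EuclideanSpace.norm_eq]
  refine Real.sqrt_le_sqrt ?_
  have h (i : Fin (d + 1)) : ‖x i‖ ^ 2 ≤ 1 := by
    have : |x i| ≤ 1 := hx ▸
      Finset.single_le_sum (f := fun i => |x i|) (fun i _ => abs_nonneg _) (Finset.mem_univ i)
    rw [Real.norm_eq_abs]
    exact pow_le_one₀ (abs_nonneg _) this
  exact (Finset.sum_le_sum fun i _ => h i).trans (by simp)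

lemma ne_zero_of_mem_crossBoundary {d : ℕ} {x : EuclideanSpace ℝ (Fin (d + 1))}
    (hx : x ∈ crossBoundary d) : x ≠ 0 := by
  rintro rfl
  simp [crossBoundary] at hx

lemma neg_mem_crossBoundary {d : ℕ} {x : EuclideanSpace ℝ (Fin (d + 1))}
    (hx : x ∈ crossBoundary d) : -x ∈ crossBoundary d := by
  simpa [crossBoundary] using hx

/-- The facet of the cross-polytope in the orthant of the sign vector `ε`. -/
def crossFacet (d : ℕ) (ε : ℕ → ℝ) : Set (EuclideanSpace ℝ (Fin (d + 1))) :=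
  {x | (∀ i : Fin (d + 1), 0 ≤ ε i * x i) ∧ ∑ i : Fin (d + 1), ε i * x i = 1}

lemma convex_crossFacet (d : ℕ) (ε : ℕ → ℝ) : Convex ℝ (crossFacet d ε) := by
  rintro x ⟨hx, hx'⟩ y ⟨hy, hy'⟩ p q hp hq hpq
  have h (i : Fin (d + 1)) : ε i * (p • x + q • y) i = p * (ε i * x i) + q * (ε i * y i) := by
    simp only [PiLp.add_apply, PiLp.smul_apply, smul_eq_mul]
    ring
  refine ⟨fun i => ?_, ?_⟩
  · rw [h]
    have := hx i
    have := hy i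
    positivity
  · simp only [h, Finset.sum_add_distrib, ← Finset.mul_sum, hx', hy', mul_one, hpq]

lemma crossFacet_subset {d : ℕ} {ε : ℕ → ℝ} (hε : ∀ i, |ε i| = 1) :
    crossFacet d ε ⊆ crossBoundary d := by
  rintro x ⟨hx, hx'⟩
  rw [crossBoundary, Set.mem_ofPred_eq, ← hx']
  refine Finset.sum_congr rfl fun i _ => ?_
  rw [← abs_of_nonneg (hx i), abs_mul, hε, one_mul]

/-- The `k`-th standard basis vector, for `k ≤ d`, with a colour that plays no role. -/
noncomputable def basisVertex (d k : ℕ) : ℕ × EuclideanSpace ℝ (Fin (d + 1)) :=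
  (0, EuclideanSpace.single (Fin.ofNat (d + 1) k) 1)

lemma exists_sign_of_mem_crossHemisphere {d k : ℕ}
    {l : List (ℕ × EuclideanSpace ℝ (Fin (d + 1)))}
    (hl : l ∈ crossHemisphere antipode (basisVertex d) k) :
    ∃ ε : ℕ → ℝ, (∀ i, |ε i| = 1) ∧
      ∀ v ∈ l, ∃ j ≤ k, v.2 = ε j • (basisVertex d j).2 := by
  induction k generalizing l with
  | zero =>
    simp only [crossHemisphere, List.mem_singleton] at hl
    subst hl
    exact ⟨fun _ => 1, by simp, by simp⟩
  | succ k ih =>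
    have hsphere : ∀ t ∈ crossHemisphere antipode (basisVertex d) k ++
        (crossHemisphere antipode (basisVertex d) k).map (List.map antipode),
        ∃ ε : ℕ → ℝ, (∀ i, |ε i| = 1) ∧ ∀ v ∈ t, ∃ j ≤ k, v.2 = ε j • (basisVertex d j).2 := by
      intro t ht
      rcases List.mem_append.1 ht with ht | ht
      · exact ih ht
      · obtain ⟨u, hu, rfl⟩ := List.mem_map.1 ht
        obtain ⟨ε, hε, h⟩ := ih hu
        refine ⟨fun i => -ε i, by simpa using hε, fun v hv => ?_⟩
        obtain ⟨w, hw, rfl⟩ := List.mem_map.1 hv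
        obtain ⟨j, hj, hwj⟩ := h w hw
        exact ⟨j, hj, by simp [antipode, hwj]⟩
    obtain ⟨t, ht, rfl⟩ := List.mem_map.1 hl
    obtain ⟨ε, hε, h⟩ := hsphere t ht
    refine ⟨Function.update ε (k + 1) 1, fun i => ?_, fun v hv => ?_⟩
    · by_cases hi : i = k + 1 <;> simp [hi, hε]
    · rcases List.mem_cons.1 hv with rfl | hv
      · exact ⟨k + 1, le_rfl, by simp⟩
      · obtain ⟨j, hj, hvj⟩ := h v hv
        exact ⟨j, by omega, by rw [Function.update_of_ne (by omega), hvj]⟩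

lemma smul_basisVertex_mem_crossFacet {d j : ℕ} (hj : j ≤ d) {ε : ℕ → ℝ}
    (hε : ∀ i, |ε i| = 1) : ε j • (basisVertex d j).2 ∈ crossFacet d ε := by
  have h (i : Fin (d + 1)) : ε i * (ε j • (basisVertex d j).2) i
      = if i = Fin.ofNat (d + 1) j then 1 else 0 := by
    by_cases hi : i = Fin.ofNat (d + 1) j
    · have hij : (i : ℕ) = j := by rw [hi]; simp [Nat.mod_eq_of_lt (Nat.lt_succ_of_le hj)]
      have : ε j * ε j = 1 := by rw [← abs_mul_abs_self, hε, one_mul]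
      rw [if_pos hi, hij]
      simp only [basisVertex, ← hi]
      simpa using this
    · rw [if_neg hi, basisVertex, PiLp.smul_apply, PiLp.single_eq_of_ne _ hi, smul_zero, mul_zero]
  refine ⟨fun i => ?_, ?_⟩
  · rw [h]
    split_ifs <;> norm_num
  · rw [Finset.sum_congr rfl fun i _ => h i]
    simp

/-- The boundary of the cross-polytope has arbitrarily fine antipodally symmetric triangulations,
presented as towers of hemispheres, whose simplices have vertices of distinct colours. -/
theorem exists_fine_tower (d : ℕ) {δ : ℝ} (hδ : 0 < δ) :
    ∃ h : ℕ → List (List (ℕ × EuclideanSpace ℝ (Fin (d + 1)))),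
      IsHemisphereTower antipode h ∧ ∀ k ≤ d, ∀ l ∈ h k,
        (∀ v ∈ l, v.1 ≤ d ∧ v.2 ∈ crossBoundary d) ∧
        (∀ v ∈ l, ∀ w ∈ l, v.1 = w.1 → v = w) ∧
        ∀ v ∈ l, ∀ w ∈ l, dist v.2 w.2 < δ := by
  -- After `N` subdivisions the simplices lie in facets and their edges are at most
  -- `2 * (d / (d + 1)) ^ N` long.
  have hiter (N : ℕ) : ∃ h : ℕ → List (List (ℕ × EuclideanSpace ℝ (Fin (d + 1)))),
      IsHemisphereTower antipode h ∧ ∀ k ≤ d, ∀ l ∈ h k,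
        (∃ ε : ℕ → ℝ, (∀ i, |ε i| = 1) ∧ ∀ v ∈ l, v.2 ∈ crossFacet d ε) ∧
        ∀ v ∈ l, ∀ w ∈ l, dist v.2 w.2 ≤ (d / (d + 1) : ℝ) ^ N * 2 := by
    induction N with
    | zero =>
      refine ⟨_, isHemisphereTower_crossHemisphere antipode_involutive (basisVertex d),
        fun k hk l hl => ?_⟩
      obtain ⟨ε, hε, h⟩ := exists_sign_of_mem_crossHemisphere hl
      have hnorm : ∀ v ∈ l, ‖v.2‖ = 1 := fun v hv => by
        obtain ⟨j, -, hj⟩ := h v hv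
        rw [hj, norm_smul, Real.norm_eq_abs, hε]
        simp [basisVertex]
      refine ⟨⟨ε, hε, fun v hv => ?_⟩, fun v hv w hw => ?_⟩
      · obtain ⟨j, hj, hvj⟩ := h v hv
        rw [hvj]
        exact smul_basisVertex_mem_crossFacet (hj.trans hk) hε
      · have := norm_sub_le v.2 w.2
        rw [hnorm v hv, hnorm w hw, ← dist_eq_norm] at this
        linarith
    | succ N ih =>
      obtain ⟨h, H, hh⟩ := ih
      refine ⟨_, H.subdiv barycenter_map_antipode, fun k hk l hl => ?_⟩
      obtain ⟨t, ht, htl⟩ := List.mem_flatMap.1 hl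
      obtain ⟨⟨ε, hε, hmem⟩, hdist⟩ := hh k hk t ht
      refine ⟨⟨ε, hε, snd_mem_of_mem_subdiv (convex_crossFacet d ε) (H.length_eq k t ht) hmem htl⟩,
        ?_⟩
      have := dist_le_of_mem_subdiv (d := d) (by positivity) (by omega) (H.length_eq k t ht) hdist
        htl
      rwa [← mul_assoc, ← pow_succ'] at this
  obtain ⟨N, hN⟩ : ∃ N : ℕ, (d / (d + 1) : ℝ) ^ N < δ / 2 :=
    exists_pow_lt_of_lt_one (by positivity) (by rw [div_lt_one (by positivity)]; linarith)
  obtain ⟨h, H, hh⟩ := hiter N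
  refine ⟨_, H.subdiv barycenter_map_antipode, fun k hk l hl => ?_⟩
  obtain ⟨t, ht, htl⟩ := List.mem_flatMap.1 hl
  obtain ⟨⟨ε, hε, hmem⟩, hdist⟩ := hh k hk t ht
  have hlen := H.length_eq k t ht
  obtain ⟨hcol, hinj⟩ := fst_of_mem_subdiv hlen htl
  refine ⟨fun v hv => ⟨by have := hcol v hv; omega, crossFacet_subset hε ?_⟩, hinj,
    fun v hv w hw => ?_⟩
  · exact snd_mem_of_mem_subdiv (convex_crossFacet d ε) hlen hmem htl v hv
  · have h1 := dist_le_of_mem_subdiv (d := d) (by positivity) (by omega) hlen hdist htl v hv w hw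
    have h2 : (d / (d + 1) : ℝ) ≤ 1 := by
      rw [div_le_one (by positivity)]
      linarith
    refine (h1.trans (mul_le_of_le_one_left (by positivity) h2)).trans_lt ?_
    linarith

/-! ### Labellings and compactness -/

/-- If every point of an antipodally symmetric set without fixed points has an admissible label,
then admissible labels can be chosen antipodally. -/
lemma exists_odd_choice {V L : Type*} {a : V → V} {o : L → L} (ha : Function.Involutive a)
    (ho : Function.Involutive o) {S : Set V} (hS : ∀ v ∈ S, a v ∈ S) (hfix : ∀ v ∈ S, a v ≠ v)
    [Nonempty L] {R : V → L → Prop} (hR : ∀ v x, R v x → R (a v) (o x)) (hex : ∀ v ∈ S, ∃ x, R v x) :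
    ∃ lab : V → L, ∀ v ∈ S, R v (lab v) ∧ lab (a v) = o (lab v) := by
  classical
  -- A well-ordering selects one point from each antipodal pair.
  have hone : ∀ v ∈ S, (WellOrderingRel (a v) v ↔ ¬ WellOrderingRel v (a v)) := fun v hv =>
    ⟨fun h h' => asymm_of WellOrderingRel h h', fun h =>
      ((trichotomous_of WellOrderingRel v (a v)).resolve_left h).resolve_left
        (hfix v hv).symm⟩
  choose! c hc using hex
  refine ⟨fun v => if WellOrderingRel v (a v) then c v else o (c (a v)), fun v hv => ?_⟩
  by_cases h : WellOrderingRel v (a v)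
  · simp [ha v, hone v hv, h, hc v hv]
  · have := hR _ _ (hc (a v) (hS v hv))
    rw [ha v] at this
    simp [ha v, hone v hv, h, this, ho (c (a v))]

/-- Closed subsets of a compact set without a common point have no points close to each other. -/
lemma exists_pos_forall_not_close {X ι : Type*} [PseudoMetricSpace X] [Nonempty ι] {K : Set X}
    (hK : IsCompact K) {C : ι → Set X} (hC : ∀ i, IsClosed (C i)) (hCK : ∀ i, C i ⊆ K)
    (hempty : ⋂ i, C i = ∅) :
    ∃ δ > 0, ∀ x : ι → X, (∀ i, x i ∈ C i) → ¬ ∀ i j, dist (x i) (x j) < δ := by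
  obtain ⟨δ, hδ, h⟩ := lebesgue_number_lemma_of_metric hK (c := fun i => (C i)ᶜ)
    (fun i => (hC i).isOpen_compl)
    (by rw [← Set.compl_iInter, hempty, Set.compl_empty]; exact Set.subset_univ _)
  refine ⟨δ, hδ, fun x hx hclose => ?_⟩
  obtain ⟨i₀⟩ := ‹Nonempty ι›
  obtain ⟨i, hi⟩ := h (x i₀) (hCK _ (hx i₀))
  exact hi (Metric.mem_ball.2 (hclose i i₀)) (hx i)

lemma exists_pos_forall_le {ι : Type*} [Finite ι] {f : ι → ℝ} (hf : ∀ i, 0 < f i) :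
    ∃ δ > 0, ∀ i, δ ≤ f i := by
  cases isEmpty_or_nonempty ι
  · exact ⟨1, one_pos, fun i => isEmptyElim i⟩
  · obtain ⟨i, hi⟩ := Finite.exists_min f
    exact ⟨f i, hf i, hi⟩

/-- The radial pullback to the boundary of the cross-polytope of a set on the round sphere. -/
def radial {d : ℕ} (A : Set (EuclideanSpace ℝ (Fin (d + 1)))) :
    Set (EuclideanSpace ℝ (Fin (d + 1))) := {x | x ∈ crossBoundary d ∧ ‖x‖⁻¹ • x ∈ A}

section Radial

variable {d : ℕ} {A : Set (EuclideanSpace ℝ (Fin (d + 1)))}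

lemma isClosed_radial (hA : IsClosed A) : IsClosed (radial A) := by
  refine ContinuousOn.preimage_isClosed_of_isClosed (f := fun x => ‖x‖⁻¹ • x) ?_
    (isCompact_crossBoundary d).isClosed hA
  exact (continuousOn_id.norm.inv₀ fun x hx =>
    norm_ne_zero_iff.2 (ne_zero_of_mem_crossBoundary hx)).smul continuousOn_id

lemma mem_radial_smul {x : EuclideanSpace ℝ (Fin (d + 1))} {c : ℝ} (hc : c = 1 ∨ c = -1) :
    c • x ∈ radial A ↔ x ∈ crossBoundary d ∧ c • ‖x‖⁻¹ • x ∈ A := by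
  have hneg : -x ∈ crossBoundary d ↔ x ∈ crossBoundary d :=
    ⟨fun h => by simpa using neg_mem_crossBoundary h, neg_mem_crossBoundary⟩
  rcases hc with rfl | rfl <;> simp [radial, hneg]

end Radial

/-! ### The colourful theorem -/

/-- The approximate theorem on the boundary of the cross-polytope. In a triangulation of mesh
below `δ`, each vertex is labelled by a set of the family that its colour selects. Opposite labels
on a simplex are excluded by `hsep`, because its vertices have distinct colours; the colours on a
simplex with alternating labels form the permutation. -/
theorem exists_perm_close {d : ℕ}
    {B : Fin (d + 1) → Fin (d + 1) → Set (EuclideanSpace ℝ (Fin (d + 1)))}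
    {s : Fin (d + 1) → ℝ} (hs : ∀ i, s i = 1 ∨ s i = -1)
    (hcover : ∀ j, ∀ x ∈ crossBoundary d, ∃ i, x ∈ B j i ∨ -x ∈ B j i) {δ : ℝ} (hδ : 0 < δ)
    (hsep : ∀ i j l, j ≠ l → ∀ x ∈ B j i, ∀ y, -y ∈ B l i → δ ≤ dist x y) :
    ∃ π : Equiv.Perm (Fin (d + 1)), ∃ x : Fin (d + 1) → EuclideanSpace ℝ (Fin (d + 1)),
      (∀ i, s i • x i ∈ B (π i) i) ∧ ∀ i j, dist (x i) (x j) < δ := by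
  -- The label `x = (i, b)` stands for the set `τ x • B j i`, where the sign `τ x` is normalized so
  -- that the labels `(i, b)` with `b` alternating in `i`, starting with `true`, have sign `s i`.
  let σ : Fin (d + 1) → Bool → ℝ := fun i b => bif b == decide (Even (i : ℕ)) then s i else -s i
  have hσs (i) : σ i (decide (Even (i : ℕ))) = s i := by simp [σ]
  have hσ1 (i b) : σ i b = 1 ∨ σ i b = -1 := by
    simp only [σ]
    cases b == decide (Even (i : ℕ)) <;> rcases hs i with h | h <;> simp [h]
  have hσneg (i b) : σ i (!b) = -σ i b := by
    simp only [σ]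
    cases b <;> cases decide (Even (i : ℕ)) <;> simp
  let τ : Fin (d + 1) ×ₗ Bool → ℝ := fun x => σ (ofLex x).1 (ofLex x).2
  have hτ1 (x) : τ x = 1 ∨ τ x = -1 := hσ1 _ _
  have hτopp (x) : τ (opp x) = -τ x := hσneg _ _
  have hopp : Function.Involutive (opp : Fin (d + 1) ×ₗ Bool → _) := fun x => by simp [opp]
  have hoppne (x : Fin (d + 1) ×ₗ Bool) : x ≠ opp x := fun h => by
    have := congrArg (fun y => (ofLex y).2) h
    simp [opp] at this
  obtain ⟨lab, hlab⟩ := exists_odd_choice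
    (a := (antipode : ℕ × EuclideanSpace ℝ (Fin (d + 1)) → _)) (o := opp)
    (S := {v | v.2 ∈ crossBoundary d})
    (R := fun v x => τ x • v.2 ∈ B (Fin.ofNat (d + 1) v.1) (ofLex x).1)
    antipode_involutive hopp (fun v hv => neg_mem_crossBoundary hv)
    (fun v hv h => ne_zero_of_mem_crossBoundary hv (by
      have h2 : -v.2 = v.2 := congrArg Prod.snd h
      have h3 : (2 : ℝ) • v.2 = 0 := by
        rw [two_smul]
        nth_rw 1 [← h2]
        exact neg_add_cancel _
      exact (smul_eq_zero.1 h3).resolve_left two_ne_zero))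
    (fun v x h => by
      change τ (opp x) • (-v.2) ∈ B (Fin.ofNat (d + 1) v.1) (ofLex x).1
      rwa [hτopp, neg_smul_neg])
    (fun v hv => by
      obtain ⟨i, hi⟩ := hcover (Fin.ofNat (d + 1) v.1) v.2 hv
      have h0 : τ (toLex (i, decide (Even (i : ℕ)))) = s i := hσs i
      have h1 : τ (opp (toLex (i, decide (Even (i : ℕ))))) = -s i := by rw [hτopp, h0]
      rcases hi with hi | hi <;> rcases hs i with h | h
      · exact ⟨_, by rw [h0, h, one_smul]; exact hi⟩
      · exact ⟨_, by rw [h1, h, neg_neg, one_smul]; exact hi⟩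
      · exact ⟨_, by rw [h1, h, neg_one_smul]; exact hi⟩
      · exact ⟨_, by rw [h0, h, neg_one_smul]; exact hi⟩)
  obtain ⟨h, H, hh⟩ := exists_fine_tower d hδ
  have hdist (x) (v w : EuclideanSpace ℝ (Fin (d + 1))) : dist (τ x • v) (τ x • w) = dist v w := by
    rcases hτ1 x with h | h <;> simp [h]
  -- The properties of the simplices of the tower are invariant under the antipodal map.
  have hsphere : ∀ k ≤ d, ∀ l ∈ h k ++ (h k).map (List.map antipode),
      (∀ v ∈ l, v.1 ≤ d ∧ v.2 ∈ crossBoundary d) ∧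
      (∀ v ∈ l, ∀ w ∈ l, v.1 = w.1 → v = w) ∧ ∀ v ∈ l, ∀ w ∈ l, dist v.2 w.2 < δ := by
    intro k hk l hl
    rcases List.mem_append.1 hl with hl | hl
    · exact hh k hk l hl
    · obtain ⟨t, ht, rfl⟩ := List.mem_map.1 hl
      obtain ⟨h1, h2, h3⟩ := hh k hk t ht
      simp only [List.forall_mem_map]
      refine ⟨fun v hv => ⟨(h1 v hv).1, neg_mem_crossBoundary (h1 v hv).2⟩,
        fun v hv w hw hvw => congrArg antipode (h2 v hv w hw hvw), fun v hv w hw => ?_⟩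
      simpa [antipode] using h3 v hv w hw
  have hcf : ∀ k ≤ d, ∀ l ∈ h k ++ (h k).map (List.map antipode), ComplementFree lab l := by
    intro k hk l hl v hv w hw hvw
    obtain ⟨h1, h2, h3⟩ := hsphere k hk l hl
    by_cases hcol : v.1 = w.1
    · rw [h2 v hv w hw hcol] at hvw
      exact hoppne _ hvw
    · have hw' := (hlab w (h1 w hw).2).1
      rw [hvw, hτopp, neg_smul] at hw'
      have := hsep (ofLex (lab v)).1 (Fin.ofNat (d + 1) v.1) (Fin.ofNat (d + 1) w.1)
        (fun e => hcol ?_) _ (hlab v (h1 v hv).2).1 _ hw'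
      · rw [hdist] at this
        exact absurd (h3 v hv w hw) this.not_gt
      · have := congrArg Fin.val e
        simpa [Nat.mod_eq_of_lt (Nat.lt_succ_of_le (h1 v hv).1),
          Nat.mod_eq_of_lt (Nat.lt_succ_of_le (h1 w hw).1)] using this
  obtain ⟨l, hl, hne⟩ := exists_alternating H lab d
    (fun j hj l hl v hv => (hlab v ((hh j hj l hl).1 v hv).2).2)
    (fun j hj l hl => hcf j hj l (List.mem_append_left _ hl))
  obtain ⟨h1, h2, h3⟩ := hsphere d le_rfl l hl
  have hlen : l.length = d + 1 := by
    rcases List.mem_append.1 hl with hl | hl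
    · exact H.length_eq d l hl
    · obtain ⟨t, ht, rfl⟩ := List.mem_map.1 hl
      rw [List.length_map, H.length_eq d t ht]
  choose v hv hvlab using
    fun i => exists_label_of_alternating hlen (hcf d le_rfl l hl) hne i
  have hinj : Function.Injective fun i => Fin.ofNat (d + 1) (v i).1 := by
    intro i j hij
    have hcol : (v i).1 = (v j).1 := by
      simpa [Nat.mod_eq_of_lt (Nat.lt_succ_of_le (h1 _ (hv i)).1),
        Nat.mod_eq_of_lt (Nat.lt_succ_of_le (h1 _ (hv j)).1)] using congrArg Fin.val hij
    have := hvlab i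
    rw [h2 _ (hv i) _ (hv j) hcol, hvlab j] at this
    exact (congrArg (fun y => (ofLex y).1) this).symm
  refine ⟨Equiv.ofBijective _ (Finite.injective_iff_bijective.1 hinj), fun i => (v i).2,
    fun i => ?_, fun i j => h3 _ (hv i) _ (hv j)⟩
  have := (hlab (v i) (h1 _ (hv i)).2).1
  rw [hvlab i] at this
  rw [← hσs i]
  exact this

end ColorfulFan

open ColorfulFan in
theorem mainTheorem2 (d : ℕ)
    -- `A j i` is the `i`-th set of the `j`-th family
    (A : Fin (d + 1) → Fin (d + 1) → Set (EuclideanSpace ℝ (Fin (d + 1))))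
    (hsub : ∀ j i, A j i ⊆ Metric.sphere 0 1)
    (hclosed : ∀ j i, IsClosed (A j i))
    (hcover : ∀ j, Metric.sphere (0 : EuclideanSpace ℝ (Fin (d + 1))) 1 =
      (⋃ i, A j i) ∪ ⋃ i, -(A j i))
    (hdisj : ∀ i j l, j ≠ l → A j i ∩ -(A l i) = ∅)
    (s : Fin (d + 1) → ℝ) (hs : ∀ i, s i = 1 ∨ s i = -1) :
    ∃ π : Equiv.Perm (Fin (d + 1)), (⋂ i, s i • A (π i) i).Nonempty := by
  have hneg1 : (-1 : ℝ) = 1 ∨ (-1 : ℝ) = -1 := Or.inr rfl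
  have hK := isCompact_crossBoundary d
  by_contra! hno
  -- A scale at which the sets of each violating permutation are apart.
  have hperm (π : Equiv.Perm (Fin (d + 1))) : ∃ δ > 0,
      ∀ x : Fin (d + 1) → EuclideanSpace ℝ (Fin (d + 1)),
        (∀ i, x i ∈ {y | s i • y ∈ radial (A (π i) i)}) → ¬ ∀ i j, dist (x i) (x j) < δ := by
    refine exists_pos_forall_not_close hK
      (fun i => (isClosed_radial (hclosed (π i) i)).preimage (continuous_const_smul (s i)))
      (fun i x hx => ((mem_radial_smul (hs i)).1 hx).1) ?_
    rw [Set.eq_empty_iff_forall_notMem]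
    intro x hx
    refine Set.eq_empty_iff_forall_notMem.1 (hno π) (‖x‖⁻¹ • x) (Set.mem_iInter.2 fun i => ?_)
    refine ⟨_, ((mem_radial_smul (hs i)).1 (Set.mem_iInter.1 hx i)).2, ?_⟩
    rcases hs i with h | h <;> simp [h]
  -- A scale at which each set is apart from the antipodes of its counterparts of other colours.
  have hpair (p : {p : Fin (d + 1) × Fin (d + 1) × Fin (d + 1) // p.2.1 ≠ p.2.2}) : ∃ δ > 0,
      ∀ x ∈ radial (A p.1.2.1 p.1.1), ∀ y, -y ∈ radial (A p.1.2.2 p.1.1) → δ ≤ dist x y := by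
    obtain ⟨⟨i, j, l⟩, hjl⟩ := p
    obtain ⟨δ, hδ, h⟩ := exists_pos_forall_not_close hK
      (C := fun b : Bool => cond b (radial (A j i)) {y | (-1 : ℝ) • y ∈ radial (A l i)})
      (fun b => by
        cases b
        · exact (isClosed_radial (hclosed l i)).preimage (continuous_const_smul (-1 : ℝ))
        · exact isClosed_radial (hclosed j i))
      (fun b x hx => by
        cases b
        · exact ((mem_radial_smul hneg1).1 hx).1
        · exact hx.1)
      (by
        rw [Set.eq_empty_iff_forall_notMem]
        intro x hx
        have h1 := Set.mem_iInter.1 hx true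
        have h2 := (mem_radial_smul hneg1).1 (Set.mem_iInter.1 hx false)
        refine Set.eq_empty_iff_forall_notMem.1 (hdisj i j l hjl) (‖x‖⁻¹ • x) ⟨h1.2, ?_⟩
        simpa using h2.2)
    refine ⟨δ, hδ, fun x hx y hy => ?_⟩
    by_contra! hxy
    refine h (fun b => cond b x y) (fun b => ?_) fun b b' => ?_
    · cases b
      · simpa using hy
      · exact hx
    · cases b <;> cases b' <;> simp [hδ, hxy, dist_comm y x]
  choose δ₁ hδ₁ hfar using hperm
  choose δ₂ hδ₂ hsep using hpair
  obtain ⟨ε₁, hε₁, hle₁⟩ := exists_pos_forall_le hδ₁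
  obtain ⟨ε₂, hε₂, hle₂⟩ := exists_pos_forall_le hδ₂
  obtain ⟨π, x, hx, hclose⟩ := exists_perm_close (B := fun j i => radial (A j i)) hs
    (fun j x hx => by
      have hx0 := ne_zero_of_mem_crossBoundary hx
      have hmem : ‖x‖⁻¹ • x ∈ Metric.sphere (0 : EuclideanSpace ℝ (Fin (d + 1))) 1 := by
        simp [norm_smul, hx0]
      rw [hcover j] at hmem
      rcases hmem with hmem | hmem <;> obtain ⟨i, hi⟩ := Set.mem_iUnion.1 hmem
      · exact ⟨i, Or.inl ⟨hx, hi⟩⟩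
      · exact ⟨i, Or.inr ⟨neg_mem_crossBoundary hx, by simpa using hi⟩⟩)
    (lt_min hε₁ hε₂)
    (fun i j l hjl x hx y hy => (min_le_right _ _).trans
      ((hle₂ ⟨(i, j, l), hjl⟩).trans (hsep ⟨(i, j, l), hjl⟩ x hx y hy)))
  exact hfar π x hx fun i j => (hclose i j).trans_le ((min_le_left _ _).trans (hle₁ π))
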